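/- Let $r$ and $m$ be positive integers with $r<m$, and assume that $r\le m-2$ or $(r,m)=(1,2)$. Let $n=2^m$ and let $\alpha_1,\dots,\alpha_n$ be an ordered list of all vectors of $\mathbb F_2^m$. Let $\mathrm{RM}(r,m)\subseteq\mathbb F_2^n$ be the binary Reed–Muller code, consisting of all words $(f(\alpha_1),\dots,f(\alpha_n))$, where $f$ ranges over the polynomials in $\mathbb F_2[X_1,\dots,X_m]$ of total degree at most $r$. Let $\mathrm{Aut}(\mathrm{RM}(r,m))\le S_n$ be its automorphism group, i.e. the group of all permutations of the $n$ coordinates that map the code onto itself (equivalently, for a generator matrix $M$ of the code, the permutations with permutation matrix $P$ such that $M=SMP$ for some invertible matrix $S$ over $\mathbb F_2$). Then the minimal degree of $\mathrm{Aut}(\mathrm{RM}(r,m))$, that is, the least number of points moved by a non-identity element of this group, is exactly $2^{m-1}=n/2$. -/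

import Mathlib

/-- The permutation automorphism group of a linear code `C ⊆ F^ι`: the permutations of the
coordinates that carry `C` onto itself. -/
def codeAut {F ι : Type*} [Field F] (C : Submodule F (ι → F)) : Subgroup (Equiv.Perm ι) where
  carrier := {σ | ∀ c : ι → F, (fun i => c (σ i)) ∈ C ↔ c ∈ C}
  one_mem' := fun _ => Iff.rfl
  mul_mem' := by
    intro σ τ hσ hτ c
    exact (hτ (fun i => c (σ i))).trans (hσ c)
  inv_mem' := by
    intro σ hσ c
    have h := hσ (fun i => c (σ⁻¹ i))
    simpa using h.symm

/-- `M` is a generator matrix of the linear code `C`: its rows form a basis of `C`. -/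
def IsGeneratorMatrix {F ι : Type*} [Field F] {k : ℕ} (M : Matrix (Fin k) ι F)
    (C : Submodule F (ι → F)) : Prop :=
  LinearIndependent F M.row ∧ Submodule.span F (Set.range M.row) = C

/-- Description of `codeAut` by a generator matrix `M` of the code: a permutation with
permutation matrix `P` is an automorphism if and only if `M = S M P` for an invertible
`k × k` matrix `S`. -/
theorem mem_codeAut_iff_generatorMatrix {F ι : Type*} [Field F] [Fintype ι] [DecidableEq ι]
    {k : ℕ} (M : Matrix (Fin k) ι F) (C : Submodule F (ι → F)) (hM : IsGeneratorMatrix M C)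
    (σ : Equiv.Perm ι) :
    σ ∈ codeAut C ↔
      ∃ S : GL (Fin k) F, M = (S : Matrix (Fin k) (Fin k) F) * M * σ.permMatrix F := by
  obtain ⟨hli, hspan⟩ := hM
  have hmem : ∀ a, M a ∈ C := fun a => hspan ▸ Submodule.subset_span ⟨a, rfl⟩
  have hcomb : ∀ N : Matrix (Fin k) ι F, (∀ a, N a ∈ C) →
      ∃ T : Matrix (Fin k) (Fin k) F, N = T * M := by
    intro N hN
    have h : ∀ a, ∃ t : Fin k → F, ∑ b, t b • M b = N a := fun a => by
      have := hN a
      rw [← hspan] at this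
      exact (Submodule.mem_span_range_iff_exists_fun F).1 this
    choose T hT using h
    refine ⟨Matrix.of T, ?_⟩
    ext a i
    rw [← hT a]
    simp [Matrix.mul_apply, Finset.sum_apply]
  have hcancel : ∀ T : Matrix (Fin k) (Fin k) F, T * M = M → T = 1 := by
    intro T hT
    have hinj := Matrix.vecMul_injective_iff.2 hli
    ext a b
    have : Matrix.vecMul (T a) M = Matrix.vecMul ((1 : Matrix (Fin k) (Fin k) F) a) M := by
      have e : ∀ X : Matrix (Fin k) (Fin k) F, Matrix.vecMul (X a) M = (X * M) a := fun X => by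
        ext i; rfl
      rw [e, e, hT, Matrix.one_mul]
    exact congrFun (hinj this) b
  have hP : ∀ (N : Matrix (Fin k) ι F) (τ : Equiv.Perm ι) (a : Fin k) (i : ι),
      (N * τ.permMatrix F) a i = N a (τ⁻¹ i) := by
    intro N τ a i
    simp [Matrix.mul_apply, Equiv.Perm.permMatrix, PEquiv.toMatrix_apply,
      ← Equiv.Perm.eq_inv_iff_eq]
  have hPP : σ.permMatrix F * (σ⁻¹).permMatrix F = 1 := by
    simp [← Matrix.permMatrix_mul]
  have hPP' : (σ⁻¹).permMatrix F * σ.permMatrix F = 1 := by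
    simp [← Matrix.permMatrix_mul]
  constructor
  · intro hσ
    have hσ' := (codeAut C).inv_mem hσ
    obtain ⟨T, hT⟩ := hcomb (M * σ.permMatrix F) fun a => by
      have : (M * σ.permMatrix F) a = fun i => M a (σ⁻¹ i) := funext (hP M σ a)
      rw [this]; exact (hσ' (M a)).2 (hmem a)
    obtain ⟨S, hS⟩ := hcomb (M * (σ⁻¹).permMatrix F) fun a => by
      have : (M * (σ⁻¹).permMatrix F) a = fun i => M a (σ i) := by
        funext i; rw [hP]; simp
      rw [this]; exact (hσ (M a)).2 (hmem a)
    have key : S * M * σ.permMatrix F = M := by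
      rw [← hS, Matrix.mul_assoc, hPP', Matrix.mul_one]
    have hST : S * T = 1 := hcancel _ (by rw [Matrix.mul_assoc, ← hT, ← Matrix.mul_assoc, key])
    exact ⟨⟨S, T, hST, mul_eq_one_comm.1 hST⟩, key.symm⟩
  · rintro ⟨S, hS⟩
    have row_mem : ∀ (T : Matrix (Fin k) (Fin k) F) (a : Fin k), (T * M) a ∈ C := by
      intro T a
      have : (T * M) a = ∑ b, T a b • M b := by
        ext i; simp [Matrix.mul_apply, Finset.sum_apply]
      rw [this]
      exact C.sum_mem fun b _ => C.smul_mem _ (hmem b)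
    have hext : ∀ τ : Equiv.Perm ι, (∀ a, (fun i => M a (τ i)) ∈ C) →
        ∀ c ∈ C, (fun i => c (τ i)) ∈ C := by
      intro τ h c hc
      have hle : C ≤ C.comap (LinearMap.funLeft F F τ) := by
        conv_lhs => rw [← hspan]
        rw [Submodule.span_le]
        rintro _ ⟨a, rfl⟩
        exact h a
      exact hle hc
    have h1 : ∀ c ∈ C, (fun i => c (σ i)) ∈ C := hext σ fun a => by
      have e : M * (σ⁻¹).permMatrix F = (S : Matrix (Fin k) (Fin k) F) * M := by
        conv_lhs => rw [hS]
        rw [Matrix.mul_assoc, hPP, Matrix.mul_one]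
      have : (fun i => M a (σ i)) = ((S : Matrix (Fin k) (Fin k) F) * M) a := by
        rw [← e]; funext i; rw [hP]; simp
      rw [this]; exact row_mem _ a
    have h2 : ∀ c ∈ C, (fun i => c (σ⁻¹ i)) ∈ C := hext σ⁻¹ fun a => by
      have e : M * σ.permMatrix F = ((S⁻¹ : GL (Fin k) F) : Matrix (Fin k) (Fin k) F) * M := by
        conv_rhs => rw [hS]
        rw [← Matrix.mul_assoc, ← Matrix.mul_assoc, Units.inv_mul, Matrix.one_mul]
      have : (fun i => M a (σ⁻¹ i)) =
          (((S⁻¹ : GL (Fin k) F) : Matrix (Fin k) (Fin k) F) * M) a := by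
        rw [← e]; funext i; rw [hP]
      rw [this]; exact row_mem _ a
    intro c
    refine ⟨fun h => ?_, h1 c⟩
    have := h2 _ h
    simpa using this

/-- The binary Reed-Muller code of order `r` and length `2 ^ m`, with respect to an ordered list
`α` of all binary vectors of length `m`: the words `(f (α₁), …, f (αₙ))`, where `f` ranges over
the polynomials over `𝔽₂` in `m` variables of total degree at most `r`. -/
noncomputable def reedMuller (r m : ℕ) (α : Fin (2 ^ m) ≃ (Fin m → ZMod 2)) :
    Submodule (ZMod 2) (Fin (2 ^ m) → ZMod 2) where
  carrier := {c | ∃ f : MvPolynomial (Fin m) (ZMod 2),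
    f.totalDegree ≤ r ∧ c = fun i => MvPolynomial.eval (α i) f}
  zero_mem' := ⟨0, by simp, by ext i; simp⟩
  add_mem' := by
    rintro _ _ ⟨f, hf, rfl⟩ ⟨g, hg, rfl⟩
    exact ⟨f + g, (MvPolynomial.totalDegree_add f g).trans (max_le hf hg), by ext i; simp⟩
  smul_mem' := by
    rintro a _ ⟨f, hf, rfl⟩
    exact ⟨a • f, (MvPolynomial.totalDegree_smul_le a f).trans hf, by
      ext i; simp [MvPolynomial.smul_eval]⟩

/-- `d` is the minimal degree of the permutation group `H`: the smallest number of points moved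
by a non-identity element of `H`. -/
def IsMinimalDegree {ι : Type*} [Fintype ι] [DecidableEq ι] (H : Subgroup (Equiv.Perm ι))
    (d : ℕ) : Prop :=
  IsLeast {s : ℕ | ∃ σ ∈ H, σ ≠ 1 ∧ σ.support.card = s} d

/-! The transvection `x ↦ x + xᵢ eⱼ` is a linear substitution, so it preserves the code, and it
moves exactly the half `xᵢ = 1` of the space. For the lower bound with `r + 2 ≤ m`, every
automorphism is affine, and an affine map with a fixed point either is the identity or fixes at most
half of the points (`card_le_two_mul_card_moved`).

Affinity comes from minimum weight words. The support of such a word is closed under `x + y + z`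
(`derivDegLE.ternary_sum_mem`). If `τ (x + y + z)` were not `τ x + τ y + τ z`, some flat of
dimension `m - r ≥ 2` would contain `τ x`, `τ y`, `τ z` but not `τ (x + y + z)`
(`exists_minWeight_word`). Pulling its indicator back along `τ` gives a minimum weight word that
contradicts closure.

Degree is measured by vanishing differences, which is coordinate-free and suits induction on the
degree. -/

/-- `derivDegLE d f`: all iterated differences of `f` of order `d + 1` vanish. -/
def derivDegLE {V : Type*} [AddCommGroup V] : ℕ → (V → ZMod 2) → Prop
  | 0, f => ∀ a x, f (x + a) = f x
  | d + 1, f => ∀ a, derivDegLE d (fun x => f (x + a) + f x)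

/-! ### Differences, degree and minimum distance -/

namespace derivDegLE

variable {V : Type*} [AddCommGroup V]

theorem zero (d : ℕ) : derivDegLE d (fun _ : V => 0) := by
  induction d with
  | zero => intro a x; rfl
  | succ d ih => intro a; simpa using ih

theorem const (d : ℕ) (c : ZMod 2) : derivDegLE d (fun _ : V => c) := by
  cases d with
  | zero => intro a x; rfl
  | succ d => intro a; simpa [CharTwo.add_self_eq_zero] using zero d

theorem add {d : ℕ} {f g : V → ZMod 2} (hf : derivDegLE d f) (hg : derivDegLE d g) :
    derivDegLE d (fun x => f x + g x) := by
  induction d generalizing f g with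
  | zero => intro a x; simp only [hf a x, hg a x]
  | succ d ih =>
    intro a
    convert ih (hf a) (hg a) using 2
    ring

theorem const_mul {d : ℕ} {f : V → ZMod 2} (c : ZMod 2) (hf : derivDegLE d f) :
    derivDegLE d (fun x => c * f x) := by
  induction d generalizing f with
  | zero => intro a x; simp only [hf a x]
  | succ d ih =>
    intro a
    convert ih (hf a) using 2
    ring

theorem succ {d : ℕ} {f : V → ZMod 2} (hf : derivDegLE d f) : derivDegLE (d + 1) f := by
  induction d generalizing f with
  | zero =>
    intro a
    simpa only [hf a, CharTwo.add_self_eq_zero] using zero 0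
  | succ d ih => exact fun a => ih (hf a)

theorem mono {d e : ℕ} (h : d ≤ e) {f : V → ZMod 2} (hf : derivDegLE d f) : derivDegLE e f := by
  induction e, h using Nat.le_induction with
  | base => exact hf
  | succ e _ ih => exact ih.succ

theorem sum {ι : Type*} (s : Finset ι) {d : ℕ} {f : ι → V → ZMod 2}
    (hf : ∀ i ∈ s, derivDegLE d (f i)) : derivDegLE d (fun x => ∑ i ∈ s, f i x) := by
  classical
  induction s using Finset.induction_on with
  | empty => simpa using zero d
  | insert i s hi ih =>
    simp only [Finset.sum_insert hi]
    exact (hf i (Finset.mem_insert_self i s)).add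
      (ih fun j hj => hf j (Finset.mem_insert_of_mem hj))

/-- Product rule: with `l (x + a) = l x + c`, the difference of `l * f` is `(l + c) * Δf + c * f`.
The induction varies `l` because `l + c` replaces it. -/
theorem mul_affine {d : ℕ} {f l : V → ZMod 2} (hl : ∀ a, ∃ c, ∀ x, l (x + a) = l x + c)
    (hf : derivDegLE d f) : derivDegLE (d + 1) (fun x => l x * f x) := by
  induction d generalizing f l with
  | zero =>
    intro a
    obtain ⟨c, hc⟩ := hl a
    convert const_mul c hf using 2 with x
    simp only [hf a x, hc x]
    linear_combination CharTwo.add_self_eq_zero (l x * f x)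
  | succ d ih =>
    intro a
    obtain ⟨c, hc⟩ := hl a
    have hl' : ∀ b, ∃ e, ∀ x, l (x + b) + c = (l x + c) + e := fun b => by
      obtain ⟨e, he⟩ := hl b
      exact ⟨e, fun x => by rw [he]; ring⟩
    convert (ih (l := fun x => l x + c) hl' (hf a)).add (const_mul c hf) using 2 with x
    simp only [hc x]
    linear_combination -c * CharTwo.add_self_eq_zero (f x)

theorem pow_mul_affine {d : ℕ} (k : ℕ) {f l : V → ZMod 2}
    (hl : ∀ a, ∃ c, ∀ x, l (x + a) = l x + c) (hf : derivDegLE d f) :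
    derivDegLE (d + k) (fun x => l x ^ k * f x) := by
  induction k with
  | zero => simpa using hf
  | succ k ih =>
    simpa only [pow_succ', mul_assoc, ← add_assoc] using mul_affine hl ih

theorem prod_pow_affine {ι : Type*} (s : Finset ι) (k : ι → ℕ) {l : ι → V → ZMod 2}
    (hl : ∀ i a, ∃ c, ∀ x, l i (x + a) = l i x + c) :
    derivDegLE (∑ i ∈ s, k i) (fun x => ∏ i ∈ s, l i x ^ k i) := by
  classical
  induction s using Finset.induction_on with
  | empty => simpa using const 0 1
  | insert i s hi ih =>
    simp only [Finset.prod_insert hi, Finset.sum_insert hi]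
    rw [add_comm]
    exact pow_mul_affine (k i) (hl i) ih

/-- The minimum distance bound for Reed-Muller codes. -/
theorem card_le [Fintype V] {d : ℕ} {f : V → ZMod 2} (hf : derivDegLE d f)
    (hne : ∃ x, f x ≠ 0) :
    Fintype.card V ≤ 2 ^ d * (Finset.univ.filter fun x => f x ≠ 0).card := by
  classical
  induction d generalizing f with
  | zero =>
    obtain ⟨x, hx⟩ := hne
    have : (Finset.univ.filter fun x => f x ≠ 0) = Finset.univ := by
      refine Finset.filter_true_of_mem fun y _ => ?_
      have := hf (y - x) x
      rw [add_sub_cancel] at this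
      rwa [this]
    rw [this]
    simp
  | succ d ih =>
    -- A nonzero difference has order `d`, and its support lies in the union of the support of `f`
    -- and a translate; this costs the factor 2. If all differences vanish, `f` is constant.
    by_cases h : ∃ a x, f (x + a) + f x ≠ 0
    · obtain ⟨a, ha⟩ := h
      have h1 := ih (hf a) ha
      have h2 : (Finset.univ.filter fun x => f (x + a) + f x ≠ 0) ⊆
          (Finset.univ.filter fun x => f (x + a) ≠ 0) ∪ Finset.univ.filter fun x => f x ≠ 0 := by
        intro x
        simp only [Finset.mem_filter, Finset.mem_univ, true_and, Finset.mem_union]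
        contrapose!
        rintro ⟨h, h'⟩
        rw [h, h', add_zero]
      have h3 : (Finset.univ.filter fun x => f (x + a) ≠ 0).card =
          (Finset.univ.filter fun x => f x ≠ 0).card :=
        Finset.card_equiv (Equiv.addRight a) (by simp)
      have h4 := (Finset.card_le_card h2).trans (Finset.card_union_le _ _)
      rw [h3, ← two_mul] at h4
      calc _ ≤ _ := h1
        _ ≤ _ := Nat.mul_le_mul_left _ h4
        _ = _ := by ring
    · push Not at h
      refine (ih (f := f) ?_ hne).trans (Nat.mul_le_mul_right _ (Nat.pow_le_pow_right two_pos
        d.le_succ))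
      exact mono (Nat.zero_le d) fun a x => CharTwo.add_eq_zero.1 (h a x)

end derivDegLE

theorem MvPolynomial.derivDegLE_eval {ι : Type*} [Fintype ι] {d : ℕ}
    (f : MvPolynomial ι (ZMod 2)) (hf : f.totalDegree ≤ d) :
    derivDegLE d (fun x => MvPolynomial.eval x f) := by
  simp only [MvPolynomial.eval_eq']
  refine derivDegLE.sum _ fun s hs => derivDegLE.const_mul _ ?_
  refine derivDegLE.mono ?_ (derivDegLE.prod_pow_affine Finset.univ s
    (l := fun i (x : ι → ZMod 2) => x i) fun i a => ⟨a i, fun x => rfl⟩)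
  rw [← Finsupp.sum_fintype s (fun _ e => e) (by simp)]
  exact (MvPolynomial.le_totalDegree hs).trans hf

/-! ### Supports of minimum weight words, by characters -/

theorem ZMod.eq_zero_or_one_of_two (a : ZMod 2) : a = 0 ∨ a = 1 := by
  revert a; decide

theorem binaryVector_add_self {ι : Type*} (x : ι → ZMod 2) : x + x = 0 :=
  funext fun i => CharTwo.add_self_eq_zero (x i)

theorem binaryVector_add_eq_zero {ι : Type*} {x y : ι → ZMod 2} : x + y = 0 ↔ x = y := by
  simp only [funext_iff, Pi.add_apply, Pi.zero_apply, CharTwo.add_eq_zero]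

theorem binaryVector_sub_eq_add {ι : Type*} (x y : ι → ZMod 2) : x - y = x + y :=
  funext fun i => CharTwo.sub_eq_add (x i) (y i)

/-- The nontrivial additive character of `ZMod 2`, with integer values. -/
def signChar (a : ZMod 2) : ℤ := if a = 0 then 1 else -1

theorem signChar_add (a b : ZMod 2) : signChar (a + b) = signChar a * signChar b := by
  revert a b; decide

theorem sum_signChar_dotProduct {ι : Type*} [Fintype ι] [DecidableEq ι] (v : ι → ZMod 2)
    (hv : v ≠ 0) : ∑ c : ι → ZMod 2, signChar (c ⬝ᵥ v) = 0 := by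
  obtain ⟨i, hi⟩ := Function.ne_iff.1 hv
  have h1 : v i = 1 := (ZMod.eq_zero_or_one_of_two _).resolve_left hi
  have h : ∑ c : ι → ZMod 2, signChar (c ⬝ᵥ v) = ∑ c : ι → ZMod 2, -signChar (c ⬝ᵥ v) := by
    refine (Fintype.sum_equiv (Equiv.addRight (Pi.single i 1)) _ _ fun c => ?_)
    simp only [Equiv.coe_addRight, add_dotProduct, single_one_dotProduct, signChar_add, h1]
    simp [signChar]
  rw [Finset.sum_neg_distrib] at h
  linarith

/-- The support of a minimum weight word of a Reed-Muller code is closed under ternary sums. -/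
theorem derivDegLE.ternary_sum_mem {ι : Type*} [Fintype ι] [DecidableEq ι] {r : ℕ}
    {f : (ι → ZMod 2) → ZMod 2} (hf : derivDegLE r f)
    (hw : 2 ^ r * (Finset.univ.filter fun x => f x ≠ 0).card = 2 ^ Fintype.card ι)
    {x y z : ι → ZMod 2} (hx : f x ≠ 0) (hy : f y ≠ 0) (hz : f z ≠ 0) : f (x + y + z) ≠ 0 := by
  intro hxyz
  set S := Finset.univ.filter fun x => f x ≠ 0 with hS
  have hV : Fintype.card (ι → ZMod 2) = 2 ^ Fintype.card ι := by simp [ZMod.card]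
  -- each affine hyperplane meets `S` in nothing, half of `S` or all of `S`
  have half : ∀ (c : ι → ZMod 2) (e : ZMod 2), (∃ s ∈ S, c ⬝ᵥ s + e ≠ 0) →
      S.card ≤ 2 * (S.filter fun s => c ⬝ᵥ s + e ≠ 0).card := by
    rintro c e ⟨s, hs, hcs⟩
    -- Cutting by a hyperplane raises the degree by one, so a nonzero cut has at least half the
    -- minimum weight.
    have hd : derivDegLE (r + 1) (fun x => (c ⬝ᵥ x + e) * f x) :=
      derivDegLE.mul_affine (l := fun x => c ⬝ᵥ x + e)
        (fun a => ⟨c ⬝ᵥ a, fun x => by rw [dotProduct_add]; ring⟩) hf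
    have h := hd.card_le ⟨s, mul_ne_zero hcs (Finset.mem_filter.1 hs).2⟩
    have he : (Finset.univ.filter fun x => (c ⬝ᵥ x + e) * f x ≠ 0) =
        S.filter fun s => c ⬝ᵥ s + e ≠ 0 := by
      ext t; simp [hS, and_comm]
    rw [he, hV, ← hw, pow_succ, mul_assoc] at h
    exact Nat.le_of_mul_le_mul_left h (by positivity)
  -- If `c` is constant on `S`, every term is 1, as four equal values cancel. Otherwise both sides
  -- of the hyperplane contain at least half of `S`, and the sum is 0.
  have key : ∀ c : ι → ZMod 2, 0 ≤ ∑ s ∈ S, signChar (c ⬝ᵥ (s + (x + y + z))) := by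
    intro c
    have hxS : x ∈ S := by simp [hS, hx]
    have hyS : y ∈ S := by simp [hS, hy]
    have hzS : z ∈ S := by simp [hS, hz]
    by_cases hc : ∀ s ∈ S, c ⬝ᵥ s = c ⬝ᵥ x
    · refine Finset.sum_nonneg fun s hs => ?_
      simp only [dotProduct_add, hc s hs, hc y hyS, hc z hzS]
      generalize c ⬝ᵥ x = a
      revert a; decide
    · push Not at hc
      obtain ⟨s, hs, hsx⟩ := hc
      have h1 := half c (c ⬝ᵥ x) ⟨s, hs, fun h => hsx (CharTwo.add_eq_zero.1 h)⟩
      have h2 := half c (c ⬝ᵥ x + 1) ⟨x, hxS, by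
        rw [← add_assoc, CharTwo.add_self_eq_zero]; decide⟩
      have h3 : (S.filter fun s => c ⬝ᵥ s + (c ⬝ᵥ x + 1) ≠ 0) =
          S.filter fun s => ¬ (c ⬝ᵥ s + c ⬝ᵥ x ≠ 0) := by
        refine Finset.filter_congr fun t _ => ?_
        generalize c ⬝ᵥ t = a
        generalize c ⬝ᵥ x = b
        revert a b; decide
      rw [h3] at h2
      have h4 := Finset.card_filter_add_card_filter_not (s := S) fun s => c ⬝ᵥ s + c ⬝ᵥ x ≠ 0
      have h5 : ∀ t, signChar (c ⬝ᵥ (t + (x + y + z))) =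
          signChar (c ⬝ᵥ t + c ⬝ᵥ x) * signChar (c ⬝ᵥ (y + z)) := fun t => by
        rw [← signChar_add]; simp only [dotProduct_add]; congr 1; ring
      simp only [h5]
      rw [← Finset.sum_mul, ← Finset.sum_filter_add_sum_filter_not S
        fun s => c ⬝ᵥ s + c ⬝ᵥ x ≠ 0]
      rw [Finset.sum_congr rfl (g := fun _ => (-1 : ℤ)), Finset.sum_congr rfl
        (s₁ := S.filter fun s => ¬ (c ⬝ᵥ s + c ⬝ᵥ x ≠ 0)) (g := fun _ => (1 : ℤ))]
      · simp only [Finset.sum_const]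
        have : (S.filter fun s => c ⬝ᵥ s + c ⬝ᵥ x ≠ 0).card =
          (S.filter fun s => ¬ (c ⬝ᵥ s + c ⬝ᵥ x ≠ 0)).card := by omega
        rw [this]
        simp
      · intro t ht
        simp only [signChar, if_pos (not_not.1 (Finset.mem_filter.1 ht).2)]
      · intro t ht
        simp only [signChar, if_neg (Finset.mem_filter.1 ht).2]
  -- By orthogonality only `s = x + y + z` could contribute, and it is not in `S`. So all the
  -- nonnegative sums vanish, yet the one at `c = 0` is `S.card`.
  have tot : ∑ c : ι → ZMod 2, ∑ s ∈ S, signChar (c ⬝ᵥ (s + (x + y + z))) = 0 := by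
    rw [Finset.sum_comm]
    refine Finset.sum_eq_zero fun s hs => sum_signChar_dotProduct _ fun h => ?_
    have : s = x + y + z := binaryVector_add_eq_zero.1 h
    exact (Finset.mem_filter.1 hs).2 (this ▸ hxyz)
  have h0 := (Finset.sum_eq_zero_iff_of_nonneg fun c _ => key c).1 tot 0 (Finset.mem_univ _)
  simp [signChar] at h0
  exact hx (by simpa [hS] using Finset.eq_empty_iff_forall_notMem.1 h0 x)

/-! ### Flats as words of the code -/

/-- A subspace not containing `v` can be enlarged to one of any given dimension less than that
of the whole space, still not containing `v`. -/
theorem Submodule.exists_le_finrank_eq_notMem {K V : Type*} [Field K] [AddCommGroup V] [Module K V]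
    [FiniteDimensional K V] (W : Submodule K V) {v : V} (hv : v ∉ W) (k : ℕ)
    (hWk : Module.finrank K W ≤ k) (hk : k < Module.finrank K V) :
    ∃ U : Submodule K V, W ≤ U ∧ v ∉ U ∧ Module.finrank K U = k := by
  induction k, hWk using Nat.le_induction with
  | base => exact ⟨W, le_rfl, hv, rfl⟩
  | succ k _ ih =>
    obtain ⟨U, hWU, hvU, hU⟩ := ih (by omega)
    -- Any vector of the hyperplane `ker φ` outside `U` may be adjoined, since `φ v ≠ 0` keeps `v`
    -- out.
    obtain ⟨φ, hφ, hUφ⟩ := Submodule.exists_le_ker_of_notMem hvU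
    have hlt : U < LinearMap.ker φ := by
      refine lt_of_le_of_ne hUφ fun h => ?_
      have h1 := LinearMap.finrank_range_add_finrank_ker φ
      have h2 := Submodule.finrank_le (LinearMap.range φ)
      rw [← h, hU] at h1
      rw [Module.finrank_self] at h2
      omega
    obtain ⟨u, huφ, huU⟩ := SetLike.exists_of_lt hlt
    refine ⟨U ⊔ K ∙ u, hWU.trans le_sup_left, fun h => hφ ?_, ?_⟩
    · exact sup_le hUφ ((Submodule.span_singleton_le_iff_mem _ _).2 huφ) h
    · rw [finrank_sup_span_singleton huU, hU]

/-- The coset `x + U` is cut out by `r` affine equations, the coordinates of `L t = L x`; the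
product of the factors `1 + L x i + L t i` is its indicator. -/
theorem exists_totalDegree_le_indicator_subspace {r m : ℕ} (hrm : r ≤ m)
    (U : Submodule (ZMod 2) (Fin m → ZMod 2)) (hU : Module.finrank (ZMod 2) U = m - r)
    (x : Fin m → ZMod 2) :
    ∃ f : MvPolynomial (Fin m) (ZMod 2), f.totalDegree ≤ r ∧
      ∀ t, MvPolynomial.eval t f ≠ 0 ↔ t + x ∈ U := by
  have hQ : Module.finrank (ZMod 2) ((Fin m → ZMod 2) ⧸ U) =
      Module.finrank (ZMod 2) (Fin r → ZMod 2) := by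
    have := Submodule.finrank_quotient_add_finrank U
    rw [hU, Module.finrank_fin_fun] at this
    rw [Module.finrank_fin_fun]
    omega
  let e := LinearEquiv.ofFinrankEq _ _ hQ
  let L : (Fin m → ZMod 2) →ₗ[ZMod 2] (Fin r → ZMod 2) := e.toLinearMap ∘ₗ U.mkQ
  have hL : ∀ t, L t = 0 ↔ t ∈ U := fun t => by simp [L]
  refine ⟨∏ i, (MvPolynomial.C (1 + L x i) +
    ∑ j, MvPolynomial.C (L (Pi.single j 1) i) * MvPolynomial.X j), ?_, fun t => ?_⟩
  · refine (MvPolynomial.totalDegree_finsetProd _ _).trans ?_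
    refine (Finset.sum_le_card_nsmul _ _ 1 fun i _ => ?_).trans (by simp)
    refine (MvPolynomial.totalDegree_add _ _).trans (max_le (by rw [MvPolynomial.totalDegree_C]; omega) ?_)
    refine MvPolynomial.totalDegree_finsetSum_le fun j _ => ?_
    refine (MvPolynomial.totalDegree_mul _ _).trans ?_
    simp
  · have ht : ∀ i, ∑ j, L (Pi.single j 1) i * t j = L t i := fun i => by
      conv_rhs => rw [L.pi_apply_eq_sum_univ t]
      simp only [Finset.sum_apply, Pi.smul_apply, smul_eq_mul]
      refine Finset.sum_congr rfl fun j _ => ?_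
      rw [mul_comm]
      congr 1
      exact congrFun (congrArg L (funext fun k => by simp [Pi.single_apply, eq_comm])) i
    rw [← hL, map_prod, Finset.prod_ne_zero_iff]
    simp only [map_add, map_sum, map_mul, MvPolynomial.eval_C, MvPolynomial.eval_X, ht,
      Finset.mem_univ, true_implies, funext_iff, Pi.add_apply, Pi.zero_apply]
    refine forall_congr' fun i => ?_
    generalize L x i = a
    generalize L t i = b
    revert a b; decide

/-- The affine span of `x, y, z` over `𝔽₂` is `{x, y, z, x + y + z}`, so it misses `u`. It grows to
a flat of dimension `m - r` avoiding `u`: `r + 2 ≤ m` leaves room for the span, and `0 < r` keeps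
the flat proper. -/
theorem exists_minWeight_word {r m : ℕ} (hr : 0 < r) (hrm : r + 2 ≤ m)
    {x y z u : Fin m → ZMod 2} (hx : u ≠ x) (hy : u ≠ y) (hz : u ≠ z) (hxyz : u ≠ x + y + z) :
    ∃ f : MvPolynomial (Fin m) (ZMod 2), f.totalDegree ≤ r ∧
      2 ^ r * (Finset.univ.filter fun t => MvPolynomial.eval t f ≠ 0).card = 2 ^ m ∧
      MvPolynomial.eval x f ≠ 0 ∧ MvPolynomial.eval y f ≠ 0 ∧ MvPolynomial.eval z f ≠ 0 ∧
      MvPolynomial.eval u f = 0 := by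
  have huW : u + x ∉ Submodule.span (ZMod 2) {y + x, z + x} := by
    rw [Submodule.mem_span_pair]
    rintro ⟨a, b, hab⟩
    have hxx : x + x = 0 := binaryVector_add_self x
    have hu : u = a • (y + x) + b • (z + x) + x := by rw [hab, add_assoc, hxx, add_zero]
    rcases ZMod.eq_zero_or_one_of_two a with rfl | rfl <;>
      rcases ZMod.eq_zero_or_one_of_two b with rfl | rfl
    · exact hx (by simpa using hu)
    · exact hz (by simpa [add_assoc, hxx] using hu)
    · exact hy (by simpa [add_assoc, hxx] using hu)
    · refine hxyz (hu.trans ?_)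
      simp only [one_smul]
      linear_combination (exp := 1) hxx
  obtain ⟨U, hWU, huU, hU⟩ := Submodule.exists_le_finrank_eq_notMem _ huW (m - r)
    ((finrank_span_le_card _).trans ((Finset.card_le_card (by simp)).trans
      ((Finset.card_le_two (a := y + x) (b := z + x)).trans (by omega))))
    (by rw [Module.finrank_fin_fun]; omega)
  obtain ⟨f, hf, hfU⟩ := exists_totalDegree_le_indicator_subspace (by omega : r ≤ m) U hU x
  refine ⟨f, hf, ?_, (hfU x).2 ?_, (hfU y).2 ?_, (hfU z).2 ?_, ?_⟩
  · have hcard : (Finset.univ.filter fun t => MvPolynomial.eval t f ≠ 0).card = 2 ^ (m - r) := by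
      classical
      have h1 : Fintype.card U = 2 ^ (m - r) := by
        rw [Module.card_eq_pow_finrank (K := ZMod 2), ZMod.card, hU]
      rw [← h1, Fintype.card_subtype]
      exact Finset.card_equiv (Equiv.addRight x) (by simp [hfU])
    rw [hcard, ← pow_add, Nat.add_sub_cancel' (by omega)]
  · rw [binaryVector_add_self]; exact U.zero_mem
  · exact hWU (Submodule.subset_span (by simp))
  · exact hWU (Submodule.subset_span (by simp))
  · by_contra h
    exact huU ((hfU u).1 h)

/-! ### Automorphisms are affine and move at least half of the points -/

/-- A permutation of the points that preserves the Reed-Muller code of order `r ≤ m - 2`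
is affine. -/
theorem map_ternary_sum_of_preserves {r m : ℕ} (hr : 0 < r) (hrm : r + 2 ≤ m)
    (τ : Equiv.Perm (Fin m → ZMod 2))
    (hτ : ∀ f : MvPolynomial (Fin m) (ZMod 2), f.totalDegree ≤ r →
      ∃ g : MvPolynomial (Fin m) (ZMod 2), g.totalDegree ≤ r ∧
        ∀ t, MvPolynomial.eval (τ t) f = MvPolynomial.eval t g) (x y z : Fin m → ZMod 2) :
    τ (x + y + z) = τ x + τ y + τ z := by
  have hself : ∀ t : Fin m → ZMod 2, t + t = 0 := binaryVector_add_self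
  -- If two points agree, both sides reduce to the image of the third. Otherwise `x + y + z` differs
  -- from `x`, `y`, `z`, as `exists_minWeight_word` needs.
  by_cases hxy : x = y
  · subst hxy; rw [hself, hself, zero_add, zero_add]
  by_cases hxz : x = z
  · subst hxz; rw [add_right_comm, hself, add_right_comm (τ x), hself, zero_add, zero_add]
  by_cases hyz : y = z
  · subst hyz; rw [add_assoc, hself, add_assoc, hself, add_zero, add_zero]
  by_contra hne
  obtain ⟨f, hf, hw, hfx, hfy, hfz, hfu⟩ := exists_minWeight_word hr hrm
    (x := τ x) (y := τ y) (z := τ z) (u := τ (x + y + z))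
    (fun h => hyz (by
      have := τ.injective h
      rwa [add_assoc, add_eq_left, binaryVector_add_eq_zero] at this))
    (fun h => hxz (by
      have := τ.injective h
      rwa [add_right_comm, add_eq_right, binaryVector_add_eq_zero] at this))
    (fun h => hxy (by
      have := τ.injective h
      rwa [add_eq_right, binaryVector_add_eq_zero] at this)) hne
  obtain ⟨g, hg, hfg⟩ := hτ f hf
  have hwg : (Finset.univ.filter fun t => MvPolynomial.eval t g ≠ 0).card =
      (Finset.univ.filter fun t => MvPolynomial.eval t f ≠ 0).card :=
    Finset.card_equiv τ (by simp [hfg])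
  refine (MvPolynomial.derivDegLE_eval g hg).ternary_sum_mem (x := x) (y := y) (z := z)
    (by rw [hwg, hw, Fintype.card_fin]) ?_ ?_ ?_ ((hfg _).symm.trans hfu)
  · rwa [← hfg]
  · rwa [← hfg]
  · rwa [← hfg]

/-- Given a fixed `q` and a moved `p`, translation by `p - q` sends fixed points to moved ones: `τ
(y - q + p) = y - q + τ p`. -/
theorem card_le_two_mul_card_moved {V : Type*} [AddCommGroup V] [Fintype V] [DecidableEq V]
    (τ : Equiv.Perm V) (hτ : ∀ x y z, τ (x - y + z) = τ x - τ y + τ z) (h1 : τ ≠ 1) :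
    Fintype.card V ≤ 2 * τ.support.card := by
  obtain ⟨p, hp⟩ : ∃ p, τ p ≠ p := by
    by_contra! h
    exact h1 (Equiv.ext h)
  have hle : τ.supportᶜ.card ≤ τ.support.card := by
    by_cases h : ∃ q, τ q = q
    · obtain ⟨q, hq⟩ := h
      refine Finset.card_le_card_of_injOn (fun y => y - q + p) (fun y hy => ?_)
        fun a _ b _ hab => by simpa using hab
      have hy' : τ y = y := by simpa using hy
      simp [hτ, hq, hy', hp]
    · push Not at h
      have : τ.supportᶜ = ∅ := by
        ext q
        simp [h q]
      simp [this]
  rw [Finset.card_compl] at hle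
  omega

/-! ### Transvections attain the bound -/

theorem MvPolynomial.totalDegree_aeval_le {R σ τ : Type*} [CommSemiring R]
    (g : σ → MvPolynomial τ R) (hg : ∀ i, (g i).totalDegree ≤ 1) (f : MvPolynomial σ R) :
    (MvPolynomial.aeval g f).totalDegree ≤ f.totalDegree := by
  rw [MvPolynomial.aeval_def, MvPolynomial.eval₂_eq]
  refine MvPolynomial.totalDegree_finsetSum_le fun s hs => ?_
  refine (MvPolynomial.totalDegree_mul _ _).trans ?_
  rw [MvPolynomial.algebraMap_eq, MvPolynomial.totalDegree_C, zero_add]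
  refine (MvPolynomial.totalDegree_finsetProd _ _).trans ?_
  refine (Finset.sum_le_sum fun i _ => ?_).trans (MvPolynomial.le_totalDegree hs)
  exact (MvPolynomial.totalDegree_pow _ _).trans
    ((Nat.mul_le_mul_left _ (hg i)).trans_eq (mul_one _))

theorem Equiv.Perm.card_support_of_swaps_fixed {V : Type*} [Fintype V] [DecidableEq V]
    (τ e : Equiv.Perm V) (h : ∀ x, τ (e x) ≠ e x ↔ τ x = x) :
    2 * τ.support.card = Fintype.card V := by
  have : τ.supportᶜ.card = τ.support.card := Finset.card_equiv e (by simp [h])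
  rw [Finset.card_compl] at this
  have := Finset.card_le_univ τ.support
  omega

/-- The transvection `x ↦ x + xᵢ eⱼ`. -/
def transvectionPerm {m : ℕ} (i j : Fin m) (hij : i ≠ j) : Equiv.Perm (Fin m → ZMod 2) :=
  have h : Function.Involutive fun x : Fin m → ZMod 2 => x + Pi.single j (x i) := fun x => by
    simp [hij, add_assoc, ← Pi.single_add, CharTwo.add_self_eq_zero]
  h.toPerm

theorem transvectionPerm_apply {m : ℕ} (i j : Fin m) (hij : i ≠ j) (x : Fin m → ZMod 2) :
    transvectionPerm i j hij x = x + Pi.single j (x i) := rfl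

theorem transvectionPerm_self {m : ℕ} (i j : Fin m) (hij : i ≠ j) (x : Fin m → ZMod 2) :
    transvectionPerm i j hij (transvectionPerm i j hij x) = x := by
  simp [transvectionPerm_apply, hij, add_assoc, ← Pi.single_add, CharTwo.add_self_eq_zero]

theorem card_support_transvectionPerm {m : ℕ} (i j : Fin m) (hij : i ≠ j) :
    2 * (transvectionPerm i j hij).support.card = 2 ^ m := by
  -- Adding `eᵢ` flips `xᵢ`, and `x` is fixed exactly when `xᵢ = 0`.
  rw [Equiv.Perm.card_support_of_swaps_fixed _ (Equiv.addRight (Pi.single i 1))]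
  · simp [ZMod.card]
  · intro x
    simp only [transvectionPerm_apply, Equiv.coe_addRight, ne_eq,
      add_eq_left, Pi.single_eq_zero_iff, Pi.add_apply, Pi.single_eq_same]
    exact (by decide : ∀ a : ZMod 2, ¬a + 1 = 0 ↔ a = 0) (x i)

theorem mem_codeAut_permCongr_transvectionPerm {r m : ℕ} (α : Fin (2 ^ m) ≃ (Fin m → ZMod 2))
    (i j : Fin m) (hij : i ≠ j) :
    α.symm.permCongr (transvectionPerm i j hij) ∈ codeAut (reedMuller r m α) := by
  have hinv : ∀ k, α.symm.permCongr (transvectionPerm i j hij)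
      (α.symm.permCongr (transvectionPerm i j hij) k) = k := fun k => by
    simp [Equiv.permCongr_apply, transvectionPerm_self]
  have key : ∀ c ∈ reedMuller r m α,
      (fun k => c (α.symm.permCongr (transvectionPerm i j hij) k)) ∈ reedMuller r m α := by
    rintro _ ⟨f, hf, rfl⟩
    -- The substitution `Xⱼ ↦ Xⱼ + Xᵢ` does not raise the degree.
    refine ⟨MvPolynomial.aeval (fun k => MvPolynomial.X k +
      if k = j then MvPolynomial.X i else 0) f,
      (MvPolynomial.totalDegree_aeval_le _ (fun k => ?_) f).trans hf, ?_⟩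
    · refine (MvPolynomial.totalDegree_add _ _).trans (max_le (by simp) ?_)
      split_ifs <;> simp
    · funext k
      simp only [MvPolynomial.aeval_eq_bind₁, ← MvPolynomial.coe_aeval_eq_eval, RingHom.coe_coe,
        MvPolynomial.aeval_bind₁]
      congr 2
      funext l
      simp only [transvectionPerm_apply, Equiv.permCongr_apply, Equiv.symm_symm,
        Equiv.apply_symm_apply, Pi.add_apply, Pi.single_apply]
      split_ifs <;> simp
  exact fun c => ⟨fun h => by simpa only [hinv] using key _ h, key c⟩

/-! ### The minimal degree -/

theorem mainTheorem2 (r m : ℕ) (hr : 0 < r) (hrm : r < m) (h : r + 2 ≤ m ∨ m = 2)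
    (α : Fin (2 ^ m) ≃ (Fin m → ZMod 2)) :
    IsMinimalDegree (codeAut (reedMuller r m α)) (2 ^ (m - 1)) ∧
      (2 : ℚ) ^ (m - 1) = (2 ^ m : ℚ) / 2 := by
  obtain ⟨n, rfl⟩ : ∃ n, m = n + 1 := ⟨m - 1, by omega⟩
  rw [Nat.add_sub_cancel]
  refine ⟨⟨?_, ?_⟩, by rw [pow_succ]; ring⟩
  · have hij : (⟨0, by omega⟩ : Fin (n + 1)) ≠ ⟨1, by omega⟩ := by simp
    have hcard : (α.symm.permCongr (transvectionPerm _ _ hij)).support.card = 2 ^ n := by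
      have h1 := card_support_transvectionPerm _ _ hij
      have h2 : (α.symm.permCongr (transvectionPerm _ _ hij)).support.card =
          (transvectionPerm _ _ hij).support.card :=
        Finset.card_equiv α (by simp [Equiv.permCongr_apply, Equiv.symm_apply_eq])
      rw [pow_succ] at h1
      omega
    refine ⟨_, mem_codeAut_permCongr_transvectionPerm α _ _ hij, fun h1 => ?_, hcard⟩
    rw [h1, Equiv.Perm.support_one, Finset.card_empty] at hcard
    exact (pow_pos two_pos n).ne hcard
  · rintro _ ⟨σ, hσ, hσ1, rfl⟩
    rcases h with h | h
    · set τ : Equiv.Perm (Fin (n + 1) → ZMod 2) := α.permCongr σ with hτdef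
      have hτα : ∀ t, τ t = α (σ (α.symm t)) := fun t => rfl
      have hτ := map_ternary_sum_of_preserves hr h τ fun f hf => by
        obtain ⟨g, hg, hfg⟩ := (hσ _).2 (⟨f, hf, rfl⟩ : _ ∈ reedMuller r (n + 1) α)
        refine ⟨g, hg, fun t => ?_⟩
        have := congrFun hfg (α.symm t)
        rwa [Equiv.apply_symm_apply] at this
      have hτ1 : τ ≠ 1 := fun h1 => hσ1 (Equiv.ext fun k => by
        have := hτα (α k)
        rw [h1, Equiv.symm_apply_apply] at this
        exact (α.injective this).symm)
      have h1 := card_le_two_mul_card_moved τ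
        (fun x y z => by simpa only [binaryVector_sub_eq_add] using hτ x y z) hτ1
      have h2 : τ.support.card = σ.support.card :=
        Finset.card_equiv α.symm (by simp [hτα, ← Equiv.eq_symm_apply])
      rw [← Fintype.card_congr α, Fintype.card_fin, pow_succ] at h1
      omega
    -- For `m = 2` the bound is 2, which holds for any non-identity permutation.
    · obtain rfl : n = 1 := by omega
      exact Equiv.Perm.two_le_card_support_of_ne_one hσ1
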